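/- Consider the reversible cellular automaton RCA 54 on configurations $\underline s=(s_x)_{x\in\mathbb Z}\in\{0,1\}^{\mathbb Z}$. Let $\chi(s_1,s_2,s_3)=s_1+s_2+s_3+s_1s_3 \pmod 2$, let $M_t$ replace $s_x$ by $\chi(s_{x-1},s_x,s_{x+1})$ simultaneously at all $x\equiv t \pmod 2$ and leave the other sites unchanged (so $M_t$ depends only on the parity of $t$), and let observables $a:\{0,1\}^{\mathbb Z}\to\mathbb R$ evolve by $a^0=a$, $a^{t+1}=U(t)a^t$ with $U(t)a=a\circ M_t$. Let $[1]_x(\underline s)=s_x$, $[1]=[1]_0$, let $\langle\cdot\rangle$ be the expectation in the maximum entropy state (the $s_x$ are independent and equal to $0$ or $1$ with probability $\tfrac12$), and set $$C(x,t)=\langle[1]_x[1]^t\rangle-\langle[1]_x\rangle\langle[1]^t\rangle,\qquad x\in\mathbb Z,\ t\in\mathbb N_0 .$$ Let $$c_0(t)=\frac14\Bigl(1+\frac{i}{\sqrt7}\Bigr)\Bigl(\frac{-1-i\sqrt7}{2}\Bigr)^t+\frac14\Bigl(1-\frac{i}{\sqrt7}\Bigr)\Bigl(\frac{-1+i\sqrt7}{2}\Bigr)^t,\qquad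 s(u)=\sum_{m=0}^{\lfloor u/2\rfloor}4^m\binom{u-2m}{m}.$$ Then: 1. For all $t\ge3$ and all $x$ with $|x|\le \frac t3+1$ and $x+t$ even, $C(x,t)=2^{-t-1}c_0(t)$; in particular it does not depend on $x$. 2. (Staggering) For all $x$ and all $t\ge0$ with $x+t$ odd, $C(x,t)=C(x,t+1)$. 3. For all $x$ and all $t\ge 0$ with $x+t$ even, $C(x,t)$ is also the covariance of $s^0_x$ and $s^t_0$, where $\underline s^0$ is distributed according to the maximum entropy state and $\underline s^{t+1}=M_t(\underline s^t)$. 4. $s(0)=s(1)=s(2)=1$ and $s(u)=s(u-1)+4s(u-3)$ for $u\ge3$; moreover $s(u)=2^{u-1}+c_0(u)$ for $u\ge0$, and $c_0(t)=2s(t-3)-s(t-2)$ for $t\ge3$. 5. In this region $C$ decays like $2^{-t/2}$: there is $K>0$ with $|C(x,t)|\le K\,2^{-t/2}$ for all $t\ge3$ and $|x|\le\frac t3+1$, and there are $k>0$ and arbitrarily large $t$ such that $|C(x,t)|\ge k\,2^{-t/2}$ for all $x$ with $|x|\le\frac t3+1$ and $x+t$ even. -/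

import Mathlib

noncomputable section

namespace RCA54

/-- Configurations of the infinite chain: `1` is an occupied site, `0` an empty one. -/
abbrev Config : Type := ℤ → ZMod 2

/-- The local rule of RCA 54, with arithmetic modulo 2. -/
def chi (s₁ s₂ s₃ : ZMod 2) : ZMod 2 := s₁ + s₂ + s₃ + s₁ * s₃

/-- The map `M^e`: the even sites are updated. -/
def stepEven (s : Config) : Config :=
  fun x => if Even x then chi (s (x - 1)) (s x) (s (x + 1)) else s x

/-- The map `M^o`: the odd sites are updated. -/
def stepOdd (s : Config) : Config :=
  fun x => if Even x then s x else chi (s (x - 1)) (s x) (s (x + 1))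

/-- The map applied at time `t`. -/
def step (t : ℕ) (s : Config) : Config :=
  if Even t then stepEven s else stepOdd s

/-- The trajectory `s^t` of the initial configuration `s^0 = s`. -/
def traj (s : Config) : ℕ → Config
  | 0 => s
  | t + 1 => step t (traj s t)

/-- Observables: real functions of the configuration. -/
abbrev Observable : Type := Config → ℝ

/-- The one-site observable `[α]_x`. -/
def site (α : ZMod 2) (x : ℤ) : Observable :=
  fun s => if s x = α then 1 else 0

/-- The propagator `U(t)` on observables, i.e. the product of the commuting local automorphisms
`U_x` over the even `x` (`t` even) or the odd `x` (`t` odd). Since `chi a · c` is an involution,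
`U_x [α β γ]_x = [α χ(α,β,γ) γ]_x` is composition with the update of the site `x`. -/
def propagator (t : ℕ) (a : Observable) : Observable :=
  fun s => a (step t s)

/-- The time-evolved observable: `a^0 = a` and `a^(t+1) = U(t) a^t`. -/
def evolve (a : Observable) : ℕ → Observable
  | 0 => a
  | t + 1 => propagator t (evolve a t)

/-- The separable state in which the sites are independent, the site `x` having the law `p x`. -/
def separableState (p : ℤ → PMF (ZMod 2)) : MeasureTheory.Measure Config :=
  MeasureTheory.Measure.infinitePi (fun x => (p x).toMeasure)

/-- The maximum entropy state: every site is occupied with probability `1/2`. -/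
def maxEntropy : MeasureTheory.Measure Config :=
  separableState (fun _ => PMF.uniformOfFintype (ZMod 2))

/-- The expectation value of an observable in the maximum entropy state. -/
def expect (a : Observable) : ℝ := ∫ s, a s ∂maxEntropy

/-- The connected correlation of two observables in the maximum entropy state. -/
def connected (a b : Observable) : ℝ :=
  expect (fun s => a s * b s) - expect a * expect b

/-- The density-density correlation `C(x,t) = ⟨[1]_x [1]_0^t⟩ - ⟨[1]_x⟩⟨[1]_0^t⟩`. -/
def corr (x : ℤ) (t : ℕ) : ℝ :=
  connected (site 1 x) (evolve (site 1 0) t)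

/-- The covariance of the occupation of `x` at time `0` and of the origin at time `t` along the
trajectory of a random initial configuration. -/
def trajCorr (x : ℤ) (t : ℕ) : ℝ :=
  connected (site 1 x) (fun s => site 1 0 (traj s t))

/-- The coefficient `c_0(t)`. -/
def c0 (t : ℕ) : ℂ :=
  (1 / 4) * (1 + Complex.I / (Real.sqrt 7 : ℂ)) *
      ((-1 - Complex.I * (Real.sqrt 7 : ℂ)) / 2) ^ t
    + (1 / 4) * (1 - Complex.I / (Real.sqrt 7 : ℂ)) *
      ((-1 + Complex.I * (Real.sqrt 7 : ℂ)) / 2) ^ t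

/-- The sum `s(u) = ∑_{m=0}^{⌊u/2⌋} 4^m binom(u-2m, m)`. -/
def sumS (u : ℕ) : ℕ :=
  ∑ m ∈ Finset.range (u / 2 + 1), 4 ^ m * Nat.choose (u - 2 * m) m

end RCA54

end

noncomputable section

namespace RCA54

/-! Around the point (x,0), the site x+m-n at time m+n gets the light-cone coordinates (m,n), and
the rule becomes a recursion across unit diamonds (`field`), whose data are the vertex bit and the
bits on two light rays. Passing from the initial configuration to these data preserves the maximum
entropy state (`measurePreserving_vee`). Hence C(x,t), with x+t even, is a quarter of `response m n`
for m = (t-x)/2, n = (t+x)/2 (`corr_eq_response`).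

Moving the vertex along one ray replaces the other ray by its update, which preserves fair bits.
This gives relations between probabilities with a few prescribed bits, and they close because memory
is lost. With boundary bit 0, the update of a ray c s with s fair is 0^k 1 c followed by fair bits,
so c survives only behind the first 1. A bit behind 0 1 then recedes from the vertex by at least two
places per update (`mean_row_congr`), so it stays invisible at (m,n) while n is at most 2m plus a
constant. This speed is the origin of the bound t/3.

The outcome is `response_succ_succ` and `response_shift`: in the region the response depends only on
t = m+n, and R(t+2) = -(R(t+1)+R(t))/2. After rescaling by 2^t the characteristic polynomial is
z²+z+2, with roots of modulus √2; this gives c_0 and the decay, the latter through the quadratic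
form in `coeff_quadratic`. The sum s(u) belongs to z³-z²-4 = (z-2)(z²+z+2). Staggering and the
trajectory form follow from invariance of the state, reversibility and reflection. -/

/-! ### Bits, rays and the update of a ray -/

/-- Disjunction of two bits, as a polynomial over `ZMod 2`. -/
def bor (a b : ZMod 2) : ZMod 2 := a + b + a * b

lemma bor_comm (a b : ZMod 2) : bor a b = bor b a := by unfold bor; ring

lemma bor_one_left (a : ZMod 2) : bor 1 a = 1 := by revert a; decide

lemma bor_one_right (a : ZMod 2) : bor a 1 = 1 := by revert a; decide

lemma bor_zero_left (a : ZMod 2) : bor 0 a = a := by revert a; decide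

lemma bit_cases (a : ZMod 2) : a = 0 ∨ a = 1 := by revert a; decide

lemma bit_add_self (a : ZMod 2) : a + a = 0 := by revert a; decide

lemma chi_eq (a b c : ZMod 2) : chi a b c = b + bor a c := by unfold chi bor; ring

/-- One-sided sequences of bits. -/
abbrev Ray : Type := ℕ → ZMod 2

/-- The ray with first entry `c`, followed by the ray `s`. -/
def push (c : ZMod 2) (s : Ray) : Ray
  | 0 => c
  | n + 1 => s n

/-- The ray without its first entry. -/
def drop (s : Ray) : Ray := fun n => s (n + 1)

@[simp] lemma push_zero (c : ZMod 2) (s : Ray) : push c s 0 = c := rfl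

@[simp] lemma push_succ (c : ZMod 2) (s : Ray) (n : ℕ) : push c s (n + 1) = s n := rfl

@[simp] lemma drop_push (c : ZMod 2) (s : Ray) : drop (push c s) = s := rfl

lemma push_drop (s : Ray) : push (s 0) (drop s) = s := by
  funext n; cases n <;> rfl

/-- The ray that starts with the list `w` and goes on with `s`. -/
def pushList : List (ZMod 2) → Ray → Ray
  | [], s => s
  | c :: w, s => push c (pushList w s)

@[simp] lemma pushList_nil (s : Ray) : pushList [] s = s := rfl

@[simp] lemma pushList_cons (c : ZMod 2) (w : List (ZMod 2)) (s : Ray) :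
    pushList (c :: w) s = push c (pushList w s) := rfl

lemma pushList_append (w u : List (ZMod 2)) (s : Ray) :
    pushList (w ++ u) s = pushList w (pushList u s) := by
  induction w with
  | nil => rfl
  | cons c w ih => simp [ih]

lemma pushList_apply_of_lt {w : List (ZMod 2)} {n : ℕ} (hn : n < w.length) (s s' : Ray) :
    pushList w s n = pushList w s' n := by
  induction w generalizing n with
  | nil => simp at hn
  | cons c w ih =>
    cases n with
    | zero => rfl
    | succ n => exact ih (by simpa using hn)

/-- The update of a light ray driven by the boundary bit `b`. -/
def upd (b : ZMod 2) (s : Ray) : Ray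
  | 0 => s 0 + bor b (s 1)
  | n + 1 => s (n + 1) + bor (upd b s n) (s (n + 2))

lemma upd_push (b c : ZMod 2) (s : Ray) :
    upd b (push c s) = push (c + bor b (s 0)) (upd (c + bor b (s 0)) s) := by
  funext n
  induction n with
  | zero => rfl
  | succ n ih =>
    cases n with
    | zero => rfl
    | succ n =>
      change s (n + 1) + bor (upd b (push c s) (n + 1)) (s (n + 2)) = _
      rw [ih]; rfl

lemma upd_one_push (c : ZMod 2) (s : Ray) : upd 1 (push c s) = push (c + 1) (upd (c + 1) s) := by
  rw [upd_push, bor_one_left]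

lemma upd_zero_push_push_self (c : ZMod 2) (s : Ray) :
    upd 0 (push c (push c s)) = push 0 (upd 0 (push c s)) := by
  rw [upd_push, push_zero, bor_zero_left, bit_add_self]

/-- With `upd_zero_push_push_self` this describes the update from boundary 0: zeros as long as the
bit `c` repeats, then 1 and `c` at the first change. -/
lemma upd_zero_push_push_add_one (c : ZMod 2) (s : Ray) :
    upd 0 (push c (push (c + 1) s)) = push 1 (push c (upd c s)) := by
  have h : c + (c + 1) = 1 := by revert c; decide
  have h' : c + 1 + 1 = c := by revert c; decide
  rw [upd_push, push_zero, bor_zero_left, h, upd_one_push, h']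

/-- The pattern 0 1 becomes 1 0 whatever bit arrives from the left, so it shields the tail: the tail
is updated from boundary 0, independently of `w` and `b`. -/
lemma exists_upd_pushList (w : List (ZMod 2)) (b : ZMod 2) :
    ∃ w' : List (ZMod 2), w'.length = w.length ∧
      ∀ s, upd b (pushList w (push 0 (push 1 s))) = pushList w' (push 1 (push 0 (upd 0 s))) := by
  induction w generalizing b with
  | nil =>
    refine ⟨[], rfl, fun s => ?_⟩
    have h : (1 : ZMod 2) + 1 = 0 := by decide
    simp only [pushList_nil]
    rw [upd_push, push_zero, bor_one_right, zero_add, upd_one_push, h]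
  | cons c w ih =>
    -- The next entry lies in `w` or is the 0 of the pattern, so the zero ray may stand for `s` and
    -- `d` does not depend on `s`.
    set d : ZMod 2 := c + bor b (pushList w (push 0 (push 1 fun _ => 0)) 0) with hd
    obtain ⟨w', hw', h⟩ := ih d
    refine ⟨d :: w', by simp [hw'], fun s => ?_⟩
    have h0 : pushList w (push 0 (push 1 s)) 0 = pushList w (push 0 (push 1 fun _ => 0)) 0 := by
      cases w <;> rfl
    rw [pushList_cons, upd_push, h0, ← hd, h, pushList_cons]

/-! ### Averages over independent fair bits -/

/-- The function `h` of a ray depends on the first `N` entries only. -/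
def DependsOnFirst (N : ℕ) (h : Ray → ℝ) : Prop :=
  ∀ s s' : Ray, (∀ i < N, s i = s' i) → h s = h s'

/-- The average of `h` over the first `N` entries, the others being `0`. -/
def avg : ℕ → (Ray → ℝ) → ℝ
  | 0, h => h fun _ => 0
  | N + 1, h => (avg N (fun s => h (push 0 s)) + avg N (fun s => h (push 1 s))) / 2

lemma DependsOnFirst.mono {N M : ℕ} {h : Ray → ℝ} (hh : DependsOnFirst N h) (hNM : N ≤ M) :
    DependsOnFirst M h := fun s s' H => hh s s' fun i hi => H i (hi.trans_le hNM)

lemma DependsOnFirst.push {N : ℕ} {h : Ray → ℝ} (hh : DependsOnFirst (N + 1) h) (c : ZMod 2) :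
    DependsOnFirst N (fun s => h (push c s)) := fun s s' H => hh _ _ fun i hi => by
  cases i with
  | zero => rfl
  | succ i => exact H i (by omega)

lemma upd_congr {N : ℕ} {s s' : Ray} (b : ZMod 2) (H : ∀ i < N + 1, s i = s' i) :
    ∀ i < N, upd b s i = upd b s' i := by
  intro i
  induction i with
  | zero =>
    intro hi
    simp only [upd]
    rw [H 0 (by omega), H 1 (by omega)]
  | succ i ih =>
    intro hi
    simp only [upd]
    rw [ih (by omega), H (i + 1) (by omega), H (i + 2) (by omega)]

lemma DependsOnFirst.upd {N : ℕ} {h : Ray → ℝ} (hh : DependsOnFirst N h) (b : ZMod 2) :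
    DependsOnFirst (N + 1) (fun s => h (upd b s)) := fun _ _ H => hh _ _ (upd_congr b H)

lemma avg_congr {h h' : Ray → ℝ} (N : ℕ) (H : ∀ s, h s = h' s) : avg N h = avg N h' := by
  rw [funext H]

lemma avg_add (N : ℕ) (h h' : Ray → ℝ) : avg N (fun s => h s + h' s) = avg N h + avg N h' := by
  induction N generalizing h h' with
  | zero => rfl
  | succ N ih => simp only [avg, ih]; ring

lemma avg_div (N : ℕ) (h : Ray → ℝ) (c : ℝ) : avg N (fun s => h s / c) = avg N h / c := by
  induction N generalizing h with
  | zero => rfl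
  | succ N ih => simp only [avg, ih]; ring

lemma avg_comm (N M : ℕ) (h : Ray → Ray → ℝ) :
    avg N (fun l => avg M (fun r => h l r)) = avg M (fun r => avg N (fun l => h l r)) := by
  induction N generalizing h with
  | zero => rfl
  | succ N ih => simp only [avg, ih]; rw [← avg_add, ← avg_div]

lemma avg_succ_eq {N : ℕ} {h : Ray → ℝ} (hh : DependsOnFirst N h) : avg (N + 1) h = avg N h := by
  induction N generalizing h with
  | zero =>
    have h1 : ∀ s, h s = h fun _ => 0 := fun s => hh _ _ fun i hi => by omega
    simp only [avg, h1 (RCA54.push _ _)]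
    ring
  | succ N ih =>
    rw [avg, ih (hh.push 0), ih (hh.push 1)]; rfl

lemma avg_eq_of_le {N M : ℕ} {h : Ray → ℝ} (hh : DependsOnFirst N h) (hNM : N ≤ M) :
    avg M h = avg N h := by
  induction M, hNM using Nat.le_induction with
  | base => rfl
  | succ M hM ih => rw [avg_succ_eq (hh.mono hM), ih]

/-- For each fixed tail, adding `c s` at most exchanges the two values of the first bit. -/
lemma avg_push_flip (N : ℕ) (h : ZMod 2 → Ray → ℝ) (c : Ray → ZMod 2) :
    avg N (fun s => h (0 + c s) s) + avg N (fun s => h (1 + c s) s)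
      = avg N (fun s => h 0 s) + avg N (fun s => h 1 s) := by
  rw [← avg_add, ← avg_add]
  refine avg_congr N fun s => ?_
  have h11 : (1 : ZMod 2) + 1 = 0 := by decide
  rcases bit_cases (c s) with hc | hc
  · simp only [hc, add_zero]
  · simp only [hc, zero_add, h11]; ring

/-- The update of a ray preserves the law of independent fair bits. -/
lemma avg_upd {N : ℕ} {h : Ray → ℝ} (hh : DependsOnFirst N h) (b : ZMod 2) :
    avg N (fun s => h (upd b s)) = avg N h := by
  induction N generalizing h b with
  | zero => exact hh _ _ fun i hi => by omega
  | succ N ih =>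
    simp only [avg, upd_push]
    rw [avg_push_flip N (fun c s => h (push c (upd c s))) (fun s => bor b (s 0)),
      ih (hh.push 0), ih (hh.push 1)]

/-- The function `h` of a ray depends on finitely many entries. -/
def FinDep (h : Ray → ℝ) : Prop := ∃ N, DependsOnFirst N h

open Classical in
/-- The average of a function of finitely many entries of a ray of independent fair bits. -/
def mean (h : Ray → ℝ) : ℝ := if H : FinDep h then avg (Nat.find H) h else 0

lemma DependsOnFirst.mean_eq {N : ℕ} {h : Ray → ℝ} (hh : DependsOnFirst N h) :
    mean h = avg N h := by
  classical
  have H : FinDep h := ⟨N, hh⟩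
  rw [mean, dif_pos H]
  exact (avg_eq_of_le (Nat.find_spec H) (Nat.find_min' H hh)).symm

lemma FinDep.push {h : Ray → ℝ} (hh : FinDep h) (c : ZMod 2) : FinDep (fun s => h (push c s)) :=
  hh.elim fun N hN => ⟨N, (hN.mono N.le_succ).push c⟩

lemma FinDep.pushList {h : Ray → ℝ} (hh : FinDep h) (w : List (ZMod 2)) :
    FinDep (fun s => h (pushList w s)) := by
  induction w generalizing h with
  | nil => exact hh
  | cons c w ih => exact ih (hh.push c)

lemma FinDep.upd {h : Ray → ℝ} (hh : FinDep h) (b : ZMod 2) : FinDep (fun s => h (upd b s)) :=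
  hh.elim fun N hN => ⟨N + 1, hN.upd b⟩

lemma FinDep.mean_eq {h : Ray → ℝ} (hh : FinDep h) :
    mean h = (mean (fun s => h (RCA54.push 0 s)) + mean (fun s => h (RCA54.push 1 s))) / 2 := by
  obtain ⟨N, hN⟩ := hh
  have h1 := hN.mono N.le_succ
  rw [h1.mean_eq, (h1.push 0).mean_eq, (h1.push 1).mean_eq, avg]

lemma FinDep.mean_upd {h : Ray → ℝ} (hh : FinDep h) (b : ZMod 2) :
    mean (fun s => h (RCA54.upd b s)) = mean h := by
  obtain ⟨N, hN⟩ := hh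
  have h1 := hN.mono N.le_succ
  rw [(hN.upd b).mean_eq, h1.mean_eq, avg_upd h1]

/-! ### Loss of memory in the update -/

/-- The first bit is forgotten by the update if it is invisible behind the first `1`. -/
lemma mean_upd_zero_push_congr {h : Ray → ℝ} (hh : FinDep h)
    (H : ∀ k, mean (fun s => h (pushList (List.replicate k 0) (push 1 (push 0 s))))
      = mean (fun s => h (pushList (List.replicate k 0) (push 1 (push 1 s))))) :
    mean (fun s => h (upd 0 (push 0 s))) = mean (fun s => h (upd 0 (push 1 s))) := by
  obtain ⟨N, hN⟩ := hh
  induction N generalizing h with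
  | zero =>
    congr 1
    funext s
    exact hN _ _ fun i hi => by omega
  | succ N ih =>
    have hh : FinDep h := ⟨_, hN⟩
    -- Condition on the next bit: if it equals `c`, a 0 is emitted and the same problem remains;
    -- otherwise 1 and `c` are emitted and the rest is fair.
    have step : ∀ c : ZMod 2, mean (fun s => h (upd 0 (push c s)))
        = (mean (fun s => h (push 0 (upd 0 (push c s)))) + mean (fun s => h (push 1 (push c s)))) / 2
        := by
      intro c
      have e := ((hh.upd 0).push c).mean_eq
      rcases bit_cases c with rfl | rfl
      · have e1 := upd_zero_push_push_add_one 0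
        rw [zero_add] at e1
        simp only [upd_zero_push_push_self, e1] at e
        rw [e, ((hh.push 1).push 0).mean_upd 0]
      · have e1 := upd_zero_push_push_add_one 1
        have h11 : (1 : ZMod 2) + 1 = 0 := by decide
        rw [h11] at e1
        simp only [upd_zero_push_push_self, e1] at e
        rw [e, ((hh.push 1).push 1).mean_upd 1, add_comm]
    -- An emitted 0 is absorbed into `h`, which then depends on one entry fewer.
    have h0 := ih (h := fun s => h (push 0 s)) (fun k => H (k + 1)) (hN.push 0)
    have h1 := H 0
    simp only [List.replicate_zero, pushList_nil] at h1
    rw [step 0, step 1, h0, h1]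

/-- If the first bit is forgotten by the update, then it may be taken to be random. -/
lemma mean_upd_zero_push {h : Ray → ℝ} (hh : FinDep h)
    (H : ∀ k, mean (fun s => h (pushList (List.replicate k 0) (push 1 (push 0 s))))
      = mean (fun s => h (pushList (List.replicate k 0) (push 1 (push 1 s))))) (c : ZMod 2) :
    mean (fun s => h (upd 0 (push c s))) = mean h := by
  have e := (hh.upd 0).mean_eq
  have e' := mean_upd_zero_push_congr hh H
  rw [hh.mean_upd] at e
  rcases bit_cases c with rfl | rfl <;> linarith

/-! ### The field in light-cone coordinates -/

/-- The field in light-cone coordinates: the solution of the local rule with the value `v` at the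
vertex and the values `l`, `r` on the two light rays that start there. -/
def field (l : Ray) (v : ZMod 2) (r : Ray) : ℕ → ℕ → ZMod 2
  | 0, 0 => v
  | 0, n + 1 => l n
  | m + 1, 0 => r m
  | m + 1, n + 1 =>
    field l v r m n + bor (field l v r (m + 1) n) (field l v r m (n + 1))

lemma field_swap (l : Ray) (v : ZMod 2) (r : Ray) (m n : ℕ) :
    field l v r m n = field r v l n m := by
  induction m generalizing n with
  | zero => cases n <;> simp only [field]
  | succ m ihm =>
    induction n with
    | zero => simp only [field]
    | succ n ihn => simp only [field]; rw [ihm, ihn, ihm, bor_comm]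

lemma field_zero_left (l : Ray) (v : ZMod 2) (r : Ray) (n : ℕ) :
    field l v r 0 n = push v l n := by
  cases n <;> simp only [field, push]

lemma field_one_left (l : Ray) (v c : ZMod 2) (r : Ray) (n : ℕ) :
    field l v (push c r) 1 n = push c (upd c (push v l)) n := by
  induction n with
  | zero => simp only [field, push]
  | succ n ih =>
    rw [field, ih, field_zero_left, field_zero_left]
    cases n <;> simp only [push, upd]

/-- The field seen from the next vertex to the right. -/
lemma field_succ_left (l : Ray) (v c : ZMod 2) (r : Ray) (m n : ℕ) :
    field l v (push c r) (m + 1) n = field (upd c (push v l)) c r m n := by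
  induction m generalizing n with
  | zero => rw [field_zero_left, field_one_left]
  | succ m ihm =>
    induction n with
    | zero => simp only [field, push]
    | succ n ihn => rw [field, ihm, ihm, ihn, field]

lemma field_congr {l l' r r' : Ray} (v : ZMod 2) {N m n : ℕ} (hm : m ≤ N) (hn : n ≤ N)
    (hl : ∀ i < N, l i = l' i) (hr : ∀ i < N, r i = r' i) :
    field l v r m n = field l' v r' m n := by
  induction m generalizing n with
  | zero =>
    cases n with
    | zero => simp only [field]
    | succ n => simp only [field]; exact hl n (by omega)
  | succ m ihm =>
    induction n with
    | zero => simp only [field]; exact hr m (by omega)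
    | succ n ihn =>
      simp only [field]
      rw [ihm (by omega) (by omega), ihm (by omega) (by omega), ihn (by omega)]

/-- The occupation number of a bit. -/
def occ (c : ZMod 2) : ℝ := if c = 1 then 1 else 0

lemma finDep_field_left (v : ZMod 2) (r : Ray) (m n : ℕ) :
    FinDep (fun l => occ (field l v r m n)) :=
  ⟨m + n, fun _ _ H => congrArg occ
    (field_congr v (Nat.le_add_right m n) (Nat.le_add_left n m) H fun _ _ => rfl)⟩

/-- A bit behind `0 1` far out on the left ray does not influence the field near the right one. -/
lemma mean_row_congr (m : ℕ) {n : ℕ} (r : Ray) (w : List (ZMod 2))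
    (hn : n ≤ w.length + 1 + 2 * m) :
    mean (fun s => occ (field (drop (pushList w (push 0 (push 1 (push 0 s)))))
        (pushList w (push 0 (push 1 (push 0 s))) 0) r m n))
      = mean (fun s => occ (field (drop (pushList w (push 0 (push 1 (push 1 s)))))
        (pushList w (push 0 (push 1 (push 1 s))) 0) r m n)) := by
  induction m generalizing r w n with
  | zero =>
    congr 1
    funext s
    rw [field_zero_left, push_drop, field_zero_left, push_drop]
    have e : ∀ c, pushList w (push 0 (push 1 (push c s))) = pushList (w ++ [0, 1]) (push c s) :=
      fun c => by rw [pushList_append]; rfl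
    rw [e, e, pushList_apply_of_lt (by simp; omega)]
  | succ m ih =>
    obtain ⟨w', hw', hu⟩ := exists_upd_pushList w (r 0)
    have key : ∀ c s, occ (field (drop (pushList w (push 0 (push 1 (push c s)))))
        (pushList w (push 0 (push 1 (push c s))) 0) r (m + 1) n)
        = occ (field (pushList w' (push 1 (push 0 (upd 0 (push c s))))) (r 0) (drop r) m n) := by
      intro c s
      conv_lhs => rw [← push_drop r]
      rw [field_succ_left, push_drop, hu]
    simp only [key]
    have hF := ((((finDep_field_left (r 0) (drop r) m n).pushList w').push 1).push 0)
    refine mean_upd_zero_push_congr hF fun k => ?_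
    -- The row again ends in 0 1 `c`. Including the new vertex, its prefix has grown by `k + 2`,
    -- which pays for the loss of 2 in passing from `m + 1` to `m`.
    have e : ∀ c s, pushList w' (push 1 (push 0 (pushList (List.replicate k 0) (push 1 (push c s)))))
        = pushList (w' ++ 1 :: List.replicate k 0) (push 0 (push 1 (push c s))) := by
      intro c s
      have : ∀ t : Ray, push 0 (pushList (List.replicate k 0) t)
          = pushList (List.replicate k 0) (push 0 t) := by
        intro t
        induction k with
        | zero => rfl
        | succ k ihk => simp only [List.replicate_succ, pushList_cons, ihk]
      rw [pushList_append, pushList_cons, this]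
    simp only [e]
    exact ih (drop r) (r 0 :: (w' ++ 1 :: List.replicate k 0))
      (by simp only [List.length_cons, List.length_append, List.length_replicate]; omega)

/-- A ray that starts with `0` forgets the bit from which its update started. -/
lemma mean_field_upd_zero_push {m n : ℕ} (r : Ray) (v c : ZMod 2) (w : List (ZMod 2))
    (hw : ∃ w', v :: w = w' ++ [0]) (hn : n ≤ w.length + 1 + 2 * m) :
    mean (fun s => occ (field (pushList w (upd 0 (push c s))) v r m n))
      = mean (fun s => occ (field (pushList w s) v r m n)) := by
  refine mean_upd_zero_push ((finDep_field_left v r m n).pushList w) (fun k => ?_) c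
  obtain ⟨w', hw'⟩ := hw
  have e : ∀ c s, push v (pushList w (pushList (List.replicate k 0) (push 1 (push c s))))
      = pushList (w' ++ List.replicate k 0) (push 0 (push 1 (push c s))) := by
    intro c s
    rw [← pushList_cons, hw', pushList_append, pushList_append]
    congr 1
    induction k with
    | zero => rfl
    | succ k ihk =>
      simp only [List.replicate_succ, pushList_cons, pushList_nil] at ihk ⊢
      rw [ihk]
  have hl : w'.length = w.length := by
    have := congrArg List.length hw'
    simpa using this.symm
  have key := mean_row_congr m r (w' ++ List.replicate k 0) (n := n)
    (by simp only [List.length_append, List.length_replicate]; omega)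
  simpa only [← e, drop_push, push_zero] using key

/-! ### Averages of the field -/

lemma mean_comm {h : Ray → Ray → ℝ} {N : ℕ} (hl : ∀ r, DependsOnFirst N fun l => h l r)
    (hr : ∀ l, DependsOnFirst N (h l)) :
    mean (fun l => mean (fun r => h l r)) = mean (fun r => mean (fun l => h l r)) := by
  have e : ∀ l, mean (fun r => h l r) = avg N (fun r => h l r) := fun l => (hr l).mean_eq
  have e' : ∀ r, mean (fun l => h l r) = avg N (fun l => h l r) := fun r => (hl r).mean_eq
  simp only [e, e']
  have d : DependsOnFirst N (fun l => avg N (fun r => h l r)) := fun l l' H =>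
    avg_congr N fun r => hl r l l' H
  have d' : DependsOnFirst N (fun r => avg N (fun l => h l r)) := fun r r' H =>
    avg_congr N fun l => hr l r r' H
  rw [d.mean_eq, d'.mean_eq, avg_comm]

/-- The probability that the field at `(m, n)` is occupied if the value at the vertex is `v`, the
left and the right light ray start with the bits `w` and `u`, and the other bits are fair. -/
def prob (m n : ℕ) (w : List (ZMod 2)) (v : ZMod 2) (u : List (ZMod 2)) : ℝ :=
  mean (fun r => mean (fun l => occ (field (pushList w l) v (pushList u r) m n)))

lemma pushList_congr {N : ℕ} (w : List (ZMod 2)) {s s' : Ray} (H : ∀ i < N, s i = s' i) :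
    ∀ i < N, pushList w s i = pushList w s' i := by
  induction w with
  | nil => exact H
  | cons c w ih =>
    intro i hi
    cases i with
    | zero => rfl
    | succ i => exact ih i (by omega)

lemma dependsOnFirst_field_left (m n : ℕ) (w : List (ZMod 2)) (v : ZMod 2) (r : Ray) :
    DependsOnFirst (m + n) (fun l => occ (field (pushList w l) v r m n)) := fun _ _ H =>
  congrArg occ (field_congr v (Nat.le_add_right m n) (Nat.le_add_left n m)
    (pushList_congr w H) fun _ _ => rfl)

lemma dependsOnFirst_field_right (m n : ℕ) (l : Ray) (v : ZMod 2) (u : List (ZMod 2)) :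
    DependsOnFirst (m + n) (fun r => occ (field l v (pushList u r) m n)) := fun _ _ H =>
  congrArg occ (field_congr v (Nat.le_add_right m n) (Nat.le_add_left n m)
    (fun _ _ => rfl) (pushList_congr u H))

/-- Left-right reflection; every relation for a step to the right thereby also serves for a step to
the left. -/
lemma prob_swap (m n : ℕ) (w : List (ZMod 2)) (v : ZMod 2) (u : List (ZMod 2)) :
    prob m n w v u = prob n m u v w := by
  unfold prob
  rw [mean_comm (N := m + n) (fun l => dependsOnFirst_field_right m n _ v u)
    (fun r => dependsOnFirst_field_left m n w v _)]
  simp only [field_swap _ _ _ m n]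

lemma prob_expand_right (m n : ℕ) (w : List (ZMod 2)) (v : ZMod 2) :
    prob m n w v [] = (prob m n w v [0] + prob m n w v [1]) / 2 := by
  have d : FinDep (fun r => mean (fun l => occ (field (pushList w l) v r m n))) :=
    ⟨m + n, fun r r' H => congrArg mean (funext fun l =>
      dependsOnFirst_field_right m n (pushList w l) v [] r r' H)⟩
  exact d.mean_eq

lemma prob_expand_left (m n : ℕ) (v : ZMod 2) (u : List (ZMod 2)) :
    prob m n [] v u = (prob m n [0] v u + prob m n [1] v u) / 2 := by
  rw [prob_swap, prob_expand_right, prob_swap n m u v [0], prob_swap n m u v [1]]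

lemma prob_succ (m n : ℕ) (w : List (ZMod 2)) (v c : ZMod 2) (u : List (ZMod 2)) :
    prob (m + 1) n w v (c :: u)
      = mean (fun r => mean (fun l =>
        occ (field (upd c (push v (pushList w l))) c (pushList u r) m n))) := by
  simp only [prob, pushList_cons, field_succ_left]

lemma prob_succ_one (m n : ℕ) (v : ZMod 2) (u : List (ZMod 2)) :
    prob (m + 1) n [] v (1 :: u) = prob m n [v + 1] 1 u := by
  rw [prob_succ]
  refine congrArg mean (funext fun r => ?_)
  simp only [pushList_nil, upd_one_push, pushList_cons]
  exact ((finDep_field_left 1 (pushList u r) m n).push (v + 1)).mean_upd (v + 1)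

/-- The new vertex is 0 and the old one is the first bit of a ray updated from 0, so it is
forgotten. This and the next relations with a bound on `n` rest on loss of memory; the others only
on invariance. -/
lemma prob_succ_zero {m n : ℕ} (v : ZMod 2) (u : List (ZMod 2)) (h : n ≤ 2 * m + 1) :
    prob (m + 1) n [] v (0 :: u) = prob m n [] 0 u := by
  rw [prob_succ]
  refine congrArg mean (funext fun r => ?_)
  exact mean_field_upd_zero_push _ 0 v [] ⟨[], rfl⟩ (by simp; omega)

lemma prob_succ_one_one {m n : ℕ} (c : ZMod 2) (u : List (ZMod 2)) (h : n ≤ 2 * m + 2) :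
    prob (m + 1) n [c] 1 (1 :: u) = prob m n [0] 1 u := by
  rw [prob_succ]
  refine congrArg mean (funext fun r => ?_)
  have h11 : (1 : ZMod 2) + 1 = 0 := by decide
  simp only [pushList_nil, pushList_cons, upd_one_push, h11]
  exact mean_field_upd_zero_push _ 1 c [0] ⟨[1], rfl⟩ (by simp; omega)

lemma prob_succ_zero_one_zero (m n : ℕ) (u : List (ZMod 2)) :
    prob (m + 1) n [0] 1 (0 :: u) = prob m n [1, 1] 0 u := by
  rw [prob_succ]
  refine congrArg mean (funext fun r => ?_)
  have h01 : (0 : ZMod 2) + 1 = 1 := by decide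
  simp only [pushList_nil, pushList_cons, upd_push 0 1, push_zero, bor_zero_left, add_zero,
    upd_one_push, h01]
  exact (((finDep_field_left 0 (pushList u r) m n).push 1).push 1).mean_upd 1

lemma prob_succ_one_one_zero {m n : ℕ} (u : List (ZMod 2)) (h : n ≤ 2 * m + 2) :
    prob (m + 1) n [1] 1 (0 :: u) = prob m n [0] 0 u := by
  rw [prob_succ]
  refine congrArg mean (funext fun r => ?_)
  simp only [pushList_nil, pushList_cons, upd_zero_push_push_self]
  exact mean_field_upd_zero_push _ 0 1 [0] ⟨[0], rfl⟩ (by simp; omega)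

/-! ### The response and its recurrences -/

/-- The response of the field at `(m, n)` to the value at the vertex. -/
def response (m n : ℕ) : ℝ := prob m n [] 1 [] - prob m n [] 0 []

lemma response_swap (m n : ℕ) : response m n = response n m := by
  rw [response, response, prob_swap m n, prob_swap m n]

/-- If the first right bit is 0 the vertex is forgotten, so only the event that it is 1 contributes.
-/
lemma response_succ_left {m n : ℕ} (h : n ≤ 2 * m + 1) :
    response (m + 1) n = (prob m n [0] 1 [] - prob m n [1] 1 []) / 2 := by
  have h11 : (1 : ZMod 2) + 1 = 0 := by decide
  rw [response, prob_expand_right, prob_expand_right (m + 1) n [] 0, prob_succ_one, prob_succ_one,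
    prob_succ_zero _ _ h, prob_succ_zero _ _ h, h11, zero_add]
  ring

/-- The recurrence across a diamond. -/
lemma response_succ_succ {m n : ℕ} (h : n ≤ 2 * m) (h' : m ≤ 2 * n + 1) :
    response (m + 1) (n + 1) = -(response m n + response m (n + 1)) / 2 := by
  have h11 : (1 : ZMod 2) + 1 = 0 := by decide
  rw [response_succ_left (by omega), response_swap m (n + 1), response_succ_left h',
    prob_swap m (n + 1), prob_swap m (n + 1), prob_succ_one, prob_succ_zero _ _ h', h11, response]
  have e := prob_expand_left n m 1 []
  rw [prob_swap m n [] 1, prob_swap m n [] 0]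
  linarith

/-- The point of this form is that the right side is symmetric under reflection, which yields
`response_shift`. -/
lemma response_add_two {m n : ℕ} (h : m ≤ 2 * n + 1) (h' : n ≤ 2 * m + 1) :
    response (m + 2) (n + 1) = (prob m n [1] 1 [1] - prob m n [] 0 []) / 4 := by
  rw [response_succ_left (m := m + 1) (by omega), prob_expand_right,
    prob_expand_right (m + 1) (n + 1) [1],
    prob_succ_one_one _ _ (by omega), prob_succ_one_one _ _ (by omega), prob_succ_zero_one_zero,
    prob_succ_one_one_zero _ (by omega), prob_swap m (n + 1) [1, 1], prob_swap m (n + 1) [0] 0,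
    prob_succ_one, prob_succ_zero _ _ h, prob_swap n m [] 0, prob_swap n m, zero_add]
  ring

/-- In the homogeneous region the response depends on the time only. -/
lemma response_shift {m n : ℕ} (h : m ≤ 2 * n + 1) (h' : n ≤ 2 * m + 1) :
    response (m + 2) (n + 1) = response (m + 1) (n + 2) := by
  rw [response_add_two h h', response_swap, response_add_two h' h, prob_swap m n [1],
    prob_swap m n []]

lemma mean_const (c : ℝ) : mean (fun _ => c) = c := by
  have h : DependsOnFirst 0 (fun _ => c) := fun _ _ _ => rfl
  rw [h.mean_eq, avg]

lemma response_succ_zero (m : ℕ) : response (m + 1) 0 = 0 := by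
  simp only [response, prob, field, sub_self]

lemma response_zero_zero : response 0 0 = 1 := by
  simp [response, prob, field, mean_const, occ]

/-- The real sequence that solves the recurrence of the homogeneous region. -/
def coeff : ℕ → ℝ
  | 0 => 1 / 2
  | 1 => 0
  | t + 2 => -coeff (t + 1) - 2 * coeff t

lemma coeff_succ_succ (t : ℕ) : coeff (t + 2) = -coeff (t + 1) - 2 * coeff t := rfl

/-- The closed form of the response in the homogeneous region. -/
theorem response_eq (t : ℕ) : ∀ m n : ℕ, m + n = t → m ≤ 2 * n + 1 → n ≤ 2 * m + 1 →
    response m n = 2 * (1 / 2) ^ t * coeff t := by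
  induction t using Nat.strong_induction_on with
  | _ t ih =>
  have interior : ∀ m n : ℕ, m + n + 2 = t → n ≤ 2 * m → m ≤ 2 * n + 1 →
      response (m + 1) (n + 1) = 2 * (1 / 2) ^ t * coeff t := by
    intro m n ht h h'
    subst ht
    rw [response_succ_succ h h', ih (m + n) (by omega) m n rfl h' (by omega),
      ih (m + n + 1) (by omega) m (n + 1) rfl (by omega) (by omega), coeff_succ_succ]
    ring
  have main : ∀ m n : ℕ, m + n = t → n ≤ m → m ≤ 2 * n + 1 →
      response m n = 2 * (1 / 2) ^ t * coeff t := by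
    intro m n ht hnm hmn
    match m, n with
    | 0, 0 => subst ht; rw [response_zero_zero]; norm_num [coeff]
    | 1, 0 => subst ht; rw [response_succ_zero]; norm_num [coeff]
    | m + 2, 0 => omega
    | 0, n + 1 => omega
    | m + 1, n + 1 =>
      by_cases hb : m ≤ 2 * n + 1
      · exact interior m n (by omega) (by omega) hb
      -- Only the edge `m = 2 * n + 2` is left; the shift moves it inward at equal time, where
      -- `interior` applies.
      · obtain ⟨k, rfl⟩ : ∃ k, m = k + 1 := ⟨m - 1, by omega⟩
        rw [response_shift (by omega) (by omega)]
        exact interior k (n + 1) (by omega) (by omega) (by omega)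
  intro m n ht h h'
  rcases le_total n m with hnm | hnm
  · exact main m n ht hnm h
  · rw [response_swap]; exact main n m (by omega) hnm h'

open MeasureTheory

/-! ### Invariance of the maximum entropy state -/

instance : IsProbabilityMeasure maxEntropy := by
  unfold maxEntropy separableState; infer_instance

lemma integral_comp_of_measurable {f : Config → Config} (hf : MeasurePreserving f maxEntropy maxEntropy)
    {g : Config → ℝ} (hg : Measurable g) :
    ∫ s, g (f s) ∂maxEntropy = ∫ s, g s ∂maxEntropy := by
  conv_rhs => rw [← hf.map_eq]
  exact (integral_map hf.measurable.aemeasurable hg.aestronglyMeasurable).symm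

/-- The configuration with the value at `y` changed. -/
def flipAt (y : ℤ) (s : Config) : Config := fun z => if z = y then s z + 1 else s z

lemma map_add_one_uniform :
    (PMF.uniformOfFintype (ZMod 2)).toMeasure.map (fun c => c + 1)
      = (PMF.uniformOfFintype (ZMod 2)).toMeasure := by
  classical
  ext A hA
  rw [Measure.map_apply (measurable_of_countable _) hA, PMF.toMeasure_uniformOfFintype_apply _ hA,
    PMF.toMeasure_uniformOfFintype_apply _ (measurable_of_countable _ hA)]
  congr 2
  exact Fintype.card_congr ((Equiv.addRight (1 : ZMod 2)).subtypeEquiv fun _ => Iff.rfl)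

lemma measurePreserving_flipAt (y : ℤ) : MeasurePreserving (flipAt y) maxEntropy maxEntropy := by
  have hm : ∀ z : ℤ, Measurable (fun c : ZMod 2 => if z = y then c + 1 else c) := fun z =>
    measurable_of_countable _
  refine ⟨measurable_pi_lambda _ fun z => (hm z).comp (measurable_pi_apply z), ?_⟩
  have := Measure.infinitePi_map_pi (fun _ : ℤ => (PMF.uniformOfFintype (ZMod 2)).toMeasure) hm
  refine this.trans (congrArg Measure.infinitePi (funext fun z => ?_))
  by_cases hz : z = y
  · simpa only [hz, if_true] using map_add_one_uniform
  · simp only [hz, if_false]; exact Measure.map_id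

open Classical in
/-- The update of the sites of a set. -/
def updateSites (A : Set ℤ) (s : Config) : Config :=
  fun y => if y ∈ A then chi (s (y - 1)) (s y) (s (y + 1)) else s y

lemma updateSites_of_mem {A : Set ℤ} {y : ℤ} (h : y ∈ A) (s : Config) :
    updateSites A s y = s y + bor (s (y - 1)) (s (y + 1)) := by
  rw [updateSites, if_pos h, chi_eq]

lemma updateSites_of_notMem {A : Set ℤ} {y : ℤ} (h : y ∉ A) (s : Config) :
    updateSites A s y = s y := by
  rw [updateSites, if_neg h]

lemma measurable_updateSites (A : Set ℤ) : Measurable (updateSites A) := by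
  refine measurable_pi_lambda _ fun y => ?_
  by_cases h : y ∈ A
  · simp only [updateSites, if_pos h]
    have : Measurable (fun p : ZMod 2 × ZMod 2 × ZMod 2 => chi p.1 p.2.1 p.2.2) :=
      measurable_of_countable _
    exact this.comp (((measurable_pi_apply (y - 1) : Measurable fun s : Config => s (y - 1))).prodMk
      ((measurable_pi_apply y : Measurable fun s : Config => s y).prodMk
        (measurable_pi_apply (y + 1) : Measurable fun s : Config => s (y + 1))))
  · simp only [updateSites, if_neg h]; exact measurable_pi_apply y

/-- The update is the identity on `D`, where both neighbours are empty, and the flip of `y` off `D`.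
Since `D` does not involve the site `y`, the flip preserves it. -/
lemma measurePreserving_updateSites_singleton (y : ℤ) :
    MeasurePreserving (updateSites {y}) maxEntropy maxEntropy := by
  refine ⟨measurable_updateSites _, ?_⟩
  ext B hB
  rw [Measure.map_apply (measurable_updateSites _) hB]
  set D : Set Config := {s | bor (s (y - 1)) (s (y + 1)) = 0} with hD
  have hDm : MeasurableSet D := by
    have : Measurable (fun p : ZMod 2 × ZMod 2 => bor p.1 p.2) := measurable_of_countable _
    exact (this.comp ((measurable_pi_apply (y - 1) : Measurable fun s : Config => s (y - 1)).prodMk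
      (measurable_pi_apply (y + 1) : Measurable fun s : Config => s (y + 1))))
      (measurableSet_singleton 0)
  have hflip : ∀ s, flipAt y s ∈ D ↔ s ∈ D := by
    intro s
    simp [hD, flipAt]
  have h0 : ∀ s ∈ D, updateSites {y} s = s := by
    intro s hs
    funext z
    by_cases hz : z = y
    · subst hz; rw [updateSites_of_mem (Set.mem_singleton _), hs, add_zero]
    · exact updateSites_of_notMem (mt Set.mem_singleton_iff.1 hz) s
  have h1 : ∀ s ∉ D, updateSites {y} s = flipAt y s := by
    intro s hs
    funext z
    by_cases hz : z = y
    · subst hz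
      rw [updateSites_of_mem (Set.mem_singleton _), (bit_cases _).resolve_left hs, flipAt, if_pos rfl]
    · rw [updateSites_of_notMem (mt Set.mem_singleton_iff.1 hz) s, flipAt, if_neg hz]
  have e0 : updateSites {y} ⁻¹' B ∩ D = B ∩ D := by
    ext s
    simp only [Set.mem_inter_iff, Set.mem_preimage]
    exact and_congr_left fun hs => by rw [h0 s hs]
  have e1 : updateSites {y} ⁻¹' B \ D = flipAt y ⁻¹' (B \ D) := by
    ext s
    simp only [Set.mem_sdiff, Set.mem_preimage, hflip]
    exact and_congr_left fun hs => by rw [h1 s hs]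
  rw [← measure_inter_add_sdiff _ hDm, e0, e1,
    (measurePreserving_flipAt y).measure_preimage (hB.diff hDm).nullMeasurableSet,
    measure_inter_add_sdiff _ hDm]

lemma updateSites_insert {A : Set ℤ} {y : ℤ} (h : y ∉ A) (h1 : y - 1 ∉ A) (h2 : y + 1 ∉ A)
    (s : Config) : updateSites (insert y A) s = updateSites {y} (updateSites A s) := by
  funext z
  by_cases hz : z = y
  · subst hz
    rw [updateSites_of_mem (Set.mem_insert _ _), updateSites_of_mem (Set.mem_singleton _), updateSites_of_notMem h,
      updateSites_of_notMem h1, updateSites_of_notMem h2]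
  · rw [updateSites_of_notMem (A := {y}) (mt Set.mem_singleton_iff.1 hz)]
    by_cases hA : z ∈ A
    · rw [updateSites_of_mem hA, updateSites_of_mem (Set.mem_insert_of_mem _ hA)]
    · rw [updateSites_of_notMem hA, updateSites_of_notMem (by simp [hz, hA])]

lemma measurePreserving_updateSites_finset (A : Finset ℤ) (hA : ∀ y ∈ A, y + 1 ∉ A) :
    MeasurePreserving (updateSites A) maxEntropy maxEntropy := by
  induction A using Finset.induction_on with
  | empty =>
    have : updateSites (↑(∅ : Finset ℤ)) = id := by
      funext s y; exact updateSites_of_notMem (by simp) s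
    rw [this]; exact MeasurePreserving.id _
  | insert y A hy ih =>
    have ih' := ih fun z hz hz' =>
      hA z (Finset.mem_insert_of_mem hz) (Finset.mem_insert_of_mem hz')
    have h1 : y - 1 ∉ A := fun h => hA (y - 1) (Finset.mem_insert_of_mem h) (by simp)
    have h2 : y + 1 ∉ A := fun h =>
      hA y (Finset.mem_insert_self _ _) (Finset.mem_insert_of_mem h)
    have : updateSites (↑(insert y A) : Set ℤ) = updateSites {y} ∘ updateSites A := by
      funext s
      rw [Finset.coe_insert]
      exact updateSites_insert (by exact_mod_cast hy) (by exact_mod_cast h1)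
        (by exact_mod_cast h2) s
    rw [this]
    exact (measurePreserving_updateSites_singleton y).comp ih'

/-- The update of pairwise nonadjacent sites preserves the maximum entropy state. -/
lemma measurePreserving_updateSites {A : Set ℤ} (hA : ∀ y ∈ A, y + 1 ∉ A) :
    MeasurePreserving (updateSites A) maxEntropy maxEntropy := by
  classical
  refine ⟨measurable_updateSites A, Measure.eq_infinitePi _ fun S t ht => ?_⟩
  have hm : MeasurableSet ((S : Set ℤ).pi t) :=
    MeasurableSet.pi S.countable_toSet fun i _ => ht i
  rw [Measure.map_apply (measurable_updateSites A) hm]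
  -- A cylinder over `S` sees only the updates at sites of `S`, so a finite set of updates suffices.
  have e : updateSites A ⁻¹' (S : Set ℤ).pi t
      = updateSites (↑(S.filter (· ∈ A)) : Set ℤ) ⁻¹' (S : Set ℤ).pi t := by
    ext s
    simp only [Set.mem_preimage, Set.mem_pi]
    refine forall₂_congr fun y hy => ?_
    by_cases h : y ∈ A
    · rw [updateSites_of_mem h, updateSites_of_mem (by simpa [h] using hy)]
    · rw [updateSites_of_notMem h, updateSites_of_notMem (by simp [h])]
  have hF := measurePreserving_updateSites_finset (S.filter (· ∈ A)) (by
    intro y hy hy'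
    exact hA y (Finset.mem_filter.1 hy).2 (Finset.mem_filter.1 hy').2)
  rw [e, hF.measure_preimage hm.nullMeasurableSet]
  exact Measure.infinitePi_pi _ fun i _ => ht i

/-- The sites of the parity of `p`. -/
def parityClass (p : ℤ) : Set ℤ := {y | Even (y + p)}

lemma step_eq (t : ℕ) : step t = updateSites (parityClass t) := by
  funext s y
  have ht : Even (t : ℤ) ↔ Even t := Int.even_coe_nat t
  by_cases h : y ∈ parityClass t
  · rw [updateSites, if_pos h]
    have h' : Even (y + (t : ℤ)) := h
    rw [Int.even_add, ht] at h'
    by_cases h2 : Even t <;> simp [step, stepEven, stepOdd, h2, h']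
  · rw [updateSites, if_neg h]
    have h' : ¬ Even (y + (t : ℤ)) := h
    rw [Int.even_add, ht] at h'
    by_cases h2 : Even t
    · have : ¬ Even y := fun hy => h' (by simp [hy, h2])
      simp [step, stepEven, h2, this]
    · have : Even y := by by_contra hy; exact h' (by simp [hy, h2])
      simp [step, stepOdd, h2, this]

lemma parityClass_congr {p q : ℤ} (h : Even (p + q)) : parityClass p = parityClass q := by
  ext y
  simp only [parityClass, Set.mem_ofPred_eq]
  rw [Int.even_add] at *
  rw [Int.even_add, h]

lemma measurePreserving_parity (p : ℤ) :
    MeasurePreserving (updateSites (parityClass p)) maxEntropy maxEntropy := by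
  refine measurePreserving_updateSites fun y hy hy' => ?_
  simp only [parityClass, Set.mem_ofPred_eq] at hy hy'
  have : Even (1 : ℤ) := by
    have := hy'.sub hy
    ring_nf at this
    exact this
  exact absurd this (by decide)

lemma measurePreserving_step (t : ℕ) : MeasurePreserving (step t) maxEntropy maxEntropy := by
  rw [step_eq]; exact measurePreserving_parity t

lemma measurable_site (α : ZMod 2) (x : ℤ) : Measurable (site α x) :=
  (measurable_of_countable fun c : ZMod 2 => if c = α then (1 : ℝ) else 0).comp
    (measurable_pi_apply x)

lemma evolve_succ (a : Observable) (t : ℕ) (s : Config) :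
    evolve a (t + 1) s = evolve a t (step t s) := rfl

lemma measurable_evolve {a : Observable} (ha : Measurable a) (t : ℕ) : Measurable (evolve a t) := by
  induction t with
  | zero => exact ha
  | succ t ih => exact ih.comp (measurePreserving_step t).measurable

/-- The staggering of the correlations. -/
lemma corr_stagger {x : ℤ} {t : ℕ} (h : ¬ Even (x + (t : ℤ))) : corr x t = corr x (t + 1) := by
  have hs : ∀ s, site 1 x (step t s) = site 1 x s := by
    intro s
    have : step t s x = s x := by rw [step_eq]; exact updateSites_of_notMem h s
    simp only [site, this]
  have hme := measurable_evolve (measurable_site 1 0) t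
  have e1 := integral_comp_of_measurable (measurePreserving_step t)
    ((measurable_site 1 x).mul hme)
  have e2 := integral_comp_of_measurable (measurePreserving_step t) hme
  simp only [Pi.mul_apply, hs] at e1
  simp only [corr, connected, expect, evolve_succ, e1, e2]

/-! ### Trajectories -/

lemma updateSites_parity_involutive (p : ℤ) (s : Config) :
    updateSites (parityClass p) (updateSites (parityClass p) s) = s := by
  funext y
  by_cases h : y ∈ parityClass p
  · have h' : Even (y + p) := h
    have h1 : y - 1 ∉ parityClass p := fun h1 => by
      have h1 : Even (y - 1 + p) := h1
      rw [show y - 1 + p = y + p - 1 by ring, Int.even_sub_one] at h1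
      exact h1 h'
    have h2 : y + 1 ∉ parityClass p := fun h1 => by
      have h1 : Even (y + 1 + p) := h1
      rw [show y + 1 + p = y + p + 1 by ring, Int.even_add_one] at h1
      exact h1 h'
    rw [updateSites_of_mem h, updateSites_of_mem h, updateSites_of_notMem h1,
      updateSites_of_notMem h2, add_assoc, bit_add_self, add_zero]
  · rw [updateSites_of_notMem h, updateSites_of_notMem h]

lemma step_step (t : ℕ) (s : Config) : step t (step t s) = s := by
  rw [step_eq]; exact updateSites_parity_involutive t s

/-- The map whose composition with an observable is the evolution for the time `t`. -/
def heis : ℕ → Config → Config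
  | 0, s => s
  | t + 1, s => heis t (step t s)

lemma evolve_eq (a : Observable) (t : ℕ) (s : Config) : evolve a t s = a (heis t s) := by
  induction t generalizing s with
  | zero => rfl
  | succ t ih => rw [evolve_succ, ih, heis]

lemma measurePreserving_heis (t : ℕ) : MeasurePreserving (heis t) maxEntropy maxEntropy := by
  induction t with
  | zero => exact MeasurePreserving.id _
  | succ t ih => exact ih.comp (measurePreserving_step t)

/-- `heis` applies the same involutions as `traj` in the opposite order. -/
lemma traj_heis (t : ℕ) (s : Config) : traj (heis t s) t = s := by
  induction t generalizing s with
  | zero => rfl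
  | succ t ih => rw [traj, heis, ih, step_step]

/-- The alternating dynamics that starts with the update of the sites of the parity of `p`. -/
def dyn (p : ℤ) : ℕ → Config → Config
  | 0, s => s
  | k + 1, s => updateSites (parityClass (p + k)) (dyn p k s)

lemma dyn_congr {p q : ℤ} (h : Even (p + q)) (k : ℕ) : dyn p k = dyn q k := by
  induction k with
  | zero => rfl
  | succ k ih =>
    funext s
    have h' : Even (p + k + (q + k)) := by
      rw [show p + k + (q + k) = p + q + (k + k) by ring]
      exact h.add (Even.add_self _)
    rw [dyn, dyn, ih, parityClass_congr h']

lemma dyn_succ (p : ℤ) (k : ℕ) (s : Config) :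
    dyn p (k + 1) s = dyn (p + 1) k (updateSites (parityClass p) s) := by
  induction k with
  | zero => simp [dyn]
  | succ k ih =>
    rw [dyn, ih, dyn]
    congr 2
    push_cast
    ring

lemma traj_eq (s : Config) (t : ℕ) : traj s t = dyn 0 t s := by
  induction t with
  | zero => rfl
  | succ t ih => rw [traj, ih, dyn, step_eq, zero_add]

/-- The first map applied is that of time t-1; `t + 1` has the same parity and avoids subtraction.
-/
lemma heis_eq (t : ℕ) (s : Config) : heis t s = dyn (t + 1) t s := by
  induction t generalizing s with
  | zero => rfl
  | succ t ih =>
    rw [heis, ih, step_eq, ← dyn_succ, dyn_congr]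
    push_cast
    exact ⟨t + 1, by ring⟩

/-- The reflection of a configuration that exchanges the origin and the site `x`. -/
def reflect (x : ℤ) (s : Config) : Config := fun y => s (x - y)

lemma measurePreserving_reflect (x : ℤ) :
    MeasurePreserving (reflect x) maxEntropy maxEntropy := by
  refine ⟨measurable_pi_lambda _ fun y => measurable_pi_apply (x - y), ?_⟩
  have := Measure.infinitePi_map_piCongrLeft
    (fun _ : ℤ => (PMF.uniformOfFintype (ZMod 2)).toMeasure) (Equiv.subLeft x)
  have e : (MeasurableEquiv.piCongrLeft (fun _ : ℤ => ZMod 2) (Equiv.subLeft x) : Config → Config)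
      = reflect x := by
    funext s y
    have := Equiv.piCongrLeft_apply_apply (fun _ : ℤ => ZMod 2) (Equiv.subLeft x) s (x - y)
    rw [Equiv.subLeft_apply, sub_sub_cancel] at this
    rw [MeasurableEquiv.coe_piCongrLeft]
    exact this
  rw [← e]
  exact this

/-- The rule is symmetric in the neighbours, and for even `x` the reflection maps each sublattice to
itself. -/
lemma updateSites_reflect {x : ℤ} (hx : Even x) (p : ℤ) (s : Config) :
    updateSites (parityClass p) (reflect x s) = reflect x (updateSites (parityClass p) s) := by
  funext y
  have hy : y ∈ parityClass p ↔ x - y ∈ parityClass p := by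
    simp only [parityClass, Set.mem_ofPred_eq, Int.even_add, Int.even_sub, hx, true_iff]
  by_cases h : y ∈ parityClass p
  · rw [updateSites_of_mem h]
    change s (x - y) + bor (s (x - (y - 1))) (s (x - (y + 1)))
      = updateSites (parityClass p) s (x - y)
    rw [updateSites_of_mem (hy.1 h), bor_comm, show x - (y + 1) = x - y - 1 by ring,
      show x - (y - 1) = x - y + 1 by ring]
  · rw [updateSites_of_notMem h, reflect, reflect, updateSites_of_notMem (mt hy.2 h)]

lemma dyn_reflect {x : ℤ} (hx : Even x) (p : ℤ) (k : ℕ) (s : Config) :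
    dyn p k (reflect x s) = reflect x (dyn p k s) := by
  induction k with
  | zero => rfl
  | succ k ih => rw [dyn, ih, updateSites_reflect hx, dyn]

lemma measurePreserving_dyn (p : ℤ) (k : ℕ) :
    MeasurePreserving (dyn p k) maxEntropy maxEntropy := by
  induction k with
  | zero => exact MeasurePreserving.id _
  | succ k ih => exact (measurePreserving_parity _).comp ih

/-- The correlation is the covariance along trajectories. -/
lemma corr_eq_trajCorr {x : ℤ} {t : ℕ} (h : Even (x + (t : ℤ))) : corr x t = trajCorr x t := by
  by_cases ht : Even (t : ℤ)
  · have hx : Even x := by rw [Int.even_add] at h; exact h.2 ht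
    have hm0 := measurable_site 1 0
    have hmx := measurable_site 1 x
    have hme := measurable_evolve hm0 t
    have htr : Measurable fun s => site 1 0 (traj s t) := by
      simp only [traj_eq]
      exact hm0.comp (measurePreserving_dyn 0 t).measurable
    have e1 := integral_comp_of_measurable (measurePreserving_heis t) (hmx.mul htr)
    have e2 := integral_comp_of_measurable (measurePreserving_heis t) htr
    have e3 := integral_comp_of_measurable (measurePreserving_reflect x)
      ((hmx.comp (measurePreserving_heis t).measurable).mul hm0)
    have e4 := integral_comp_of_measurable (measurePreserving_heis t) hm0
    have hr1 : ∀ s, site 1 x (heis t (reflect x s)) = evolve (site 1 0) t s := by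
      intro s
      rw [evolve_eq, heis_eq, dyn_reflect hx, ← heis_eq]
      simp only [site, reflect, sub_self]
    have hr2 : ∀ s, site 1 0 (reflect x s) = site 1 x s := by
      intro s
      simp only [site, reflect, sub_zero]
    simp only [Pi.mul_apply, Function.comp_apply, traj_heis, hr1, hr2] at e1 e2 e3
    simp only [corr, trajCorr, connected, expect]
    -- For even `t`, substituting the inverse evolution moves the time to the site `x`; the
    -- reflection then exchanges `x` and the origin.
    rw [← e1, ← e2, ← e3]
    simp only [evolve_eq, e4]
    simp only [mul_comm]
  -- For odd `t` the sequence of sublattices is a palindrome, so both orders give the same map.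
  · have e : ∀ s, evolve (site 1 0) t s = site 1 0 (traj s t) := by
      intro s
      rw [evolve_eq, heis_eq, traj_eq, dyn_congr]
      rw [add_zero, Int.even_add_one]
      exact ht
    rw [corr, trajCorr, funext e]

/-! ### Light-cone coordinates of the dynamics -/

/-- The values along the two light rays from `(x, 0)`, up to the time `T`, when the sites of the
parity of `x + 1` are updated first. -/
def vee (x : ℤ) (T : ℕ) (s : Config) : Config :=
  fun y => dyn (x + 1) (min T (y - x).natAbs) s y

/-- Sites nearer than `T + 1` are frozen at the light ray; the others still follow the dynamics, and
so do their neighbours up to time `T`. Each step is thus an update of nonadjacent sites, hence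
measure preserving. -/
lemma vee_succ (x : ℤ) (T : ℕ) (s : Config) :
    vee x (T + 1) s
      = updateSites ({y | T + 1 ≤ (y - x).natAbs} ∩ parityClass (x + 1 + T)) (vee x T s) := by
  funext y
  by_cases hT : T + 1 ≤ (y - x).natAbs
  · have e : vee x (T + 1) s y = updateSites (parityClass (x + 1 + T)) (dyn (x + 1) T s) y := by
      rw [vee, min_eq_left hT, dyn]
    have h0 : ∀ z, T ≤ (z - x).natAbs → vee x T s z = dyn (x + 1) T s z := fun z hz => by
      rw [vee, min_eq_left hz]
    rw [e]
    by_cases hp : y ∈ parityClass (x + 1 + T)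
    · rw [updateSites_of_mem hp, updateSites_of_mem (Set.mem_inter hT hp), h0 _ (by omega), h0 _ (by omega),
        h0 _ (by omega)]
    · rw [updateSites_of_notMem hp, updateSites_of_notMem fun h => hp h.2, h0 _ (by omega)]
  · rw [updateSites_of_notMem fun h => hT h.1, vee, vee, min_eq_right (by omega),
      min_eq_right (by omega)]

lemma parityClass_succ_notMem {p y : ℤ} (h : y ∈ parityClass p) : y + 1 ∉ parityClass p := by
  intro h'
  simp only [parityClass, Set.mem_ofPred_eq] at h h'
  rw [show y + 1 + p = y + p + 1 by ring, Int.even_add_one] at h'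
  exact h' h

lemma measurePreserving_vee (x : ℤ) (T : ℕ) :
    MeasurePreserving (vee x T) maxEntropy maxEntropy := by
  induction T with
  | zero =>
    have : vee x 0 = id := by
      funext s y
      rw [vee, Nat.zero_min, dyn, id]
    rw [this]; exact MeasurePreserving.id _
  | succ T ih =>
    have : vee x (T + 1) = updateSites ({y | T + 1 ≤ (y - x).natAbs} ∩ parityClass (x + 1 + T))
        ∘ vee x T := funext (vee_succ x T)
    rw [this]
    exact (measurePreserving_updateSites fun y hy hy' =>
      parityClass_succ_notMem hy.2 hy'.2).comp ih

/-- The ray to the right of `x`. -/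
def rightRay (x : ℤ) (s : Config) : Ray := fun j => s (x + 1 + j)

/-- The ray to the left of `x`. -/
def leftRay (x : ℤ) (s : Config) : Ray := fun j => s (x - 1 - j)

lemma dyn_succ_of_notMem {p y : ℤ} {k : ℕ} (h : y ∉ parityClass (p + k)) (s : Config) :
    dyn p (k + 1) s y = dyn p k s y := by
  rw [dyn, updateSites_of_notMem h]

lemma dyn_eq_field (x : ℤ) (T : ℕ) (s : Config) (m n : ℕ) (h : m + n ≤ T) :
    dyn (x + 1) (m + n) s (x + m - n)
      = field (leftRay x (vee x T s)) (vee x T s x) (rightRay x (vee x T s)) m n := by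
  induction m generalizing n with
  | zero =>
    cases n with
    | zero => simp [field, vee, dyn]
    | succ n =>
      simp only [field, leftRay, vee]
      rw [show (x - 1 - (n : ℤ) - x).natAbs = n + 1 by omega, min_eq_right (by omega), zero_add]
      congr 1
      push_cast
      ring
  | succ m ihm =>
    induction n with
    | zero =>
      simp only [field, rightRay, vee]
      rw [show (x + 1 + (m : ℤ) - x).natAbs = m + 1 by omega, min_eq_right (by omega)]
      congr 1
      push_cast
      ring
    | succ n ihn =>
      have e1 := ihm n (by omega)
      have e2 := ihm (n + 1) (by omega)
      have e3 := ihn (by omega)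
      rw [field, ← e1, ← e2, ← e3, bor_comm]
      have hy : x + ((m + 1 : ℕ) : ℤ) - ((n + 1 : ℕ) : ℤ) = x + m - n := by push_cast; ring
      have hmem : x + (m : ℤ) - n ∈ parityClass (x + 1 + ((m + n + 1 : ℕ) : ℤ)) := by
        refine ⟨x + m + 1, ?_⟩
        push_cast
        ring
      -- The site is idle in the step before its update, so the bottom of the diamond is its value
      -- at time `m + n`.
      have hnot : x + (m : ℤ) - n ∉ parityClass (x + 1 + ((m + n : ℕ) : ℤ)) := by
        intro hc
        obtain ⟨a, ha⟩ := hc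
        push_cast at ha
        omega
      rw [hy, show m + 1 + (n + 1) = m + n + 1 + 1 by ring, dyn, updateSites_of_mem hmem,
        dyn_succ_of_notMem hnot, show m + (n + 1) = m + n + 1 by ring,
        show m + 1 + n = m + n + 1 by ring]
      congr 3 <;> · push_cast; ring

/-! ### Integrals as averages -/

/-- Average the integrand with its image under the flip at `y`, which preserves the state and runs
through both values of the bit. -/
lemma integral_eq_integral_update (y : ℤ) {h : ZMod 2 → Config → ℝ}
    (hm : ∀ c, Measurable (h c)) (hb : ∀ c s, |h c s| ≤ 1)
    (hi : ∀ c s, h c (flipAt y s) = h c s) :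
    ∫ s, h (s y) s ∂maxEntropy = ∫ s, (h 0 s + h 1 s) / 2 ∂maxEntropy := by
  have hmy : Measurable fun s : Config => s y := measurable_pi_apply y
  have hm' : Measurable fun s : Config => h (s y) s := by
    have : (fun s : Config => h (s y) s) = fun s => if s y = 0 then h 0 s else h 1 s := by
      funext s
      rcases bit_cases (s y) with e | e <;> simp [e]
    rw [this]
    exact Measurable.ite (hmy (measurableSet_singleton 0)) (hm 0) (hm 1)
  have int : ∀ g : Config → ℝ, Measurable g → (∀ s, |g s| ≤ 1) → Integrable g maxEntropy :=
    fun g hg hb => Integrable.of_bound hg.aestronglyMeasurable 1 (Filter.Eventually.of_forall hb)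
  have hm2 : Measurable fun s : Config => h (flipAt y s y) (flipAt y s) :=
    hm'.comp (measurePreserving_flipAt y).measurable
  have e := integral_comp_of_measurable (measurePreserving_flipAt y) hm'
  have e2 : ∫ s, (h (s y) s + h (flipAt y s y) (flipAt y s)) ∂maxEntropy
      = ∫ s, (h 0 s + h 1 s) ∂maxEntropy := by
    refine integral_congr_ae (Filter.Eventually.of_forall fun s => ?_)
    have h11 : (1 : ZMod 2) + 1 = 0 := by decide
    have hf : flipAt y s y = s y + 1 := by simp [flipAt]
    simp only [hi, hf]
    rcases bit_cases (s y) with e | e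
    · simp [e]
    · simp only [e, h11]; ring
  rw [integral_add (int _ hm' fun s => hb _ s) (int _ hm2 fun s => hb _ _), e] at e2
  rw [integral_div, ← e2]
  ring

lemma measurable_push {α : Type*} [MeasurableSpace α] {f : α → Ray} (hf : Measurable f)
    (c : ZMod 2) : Measurable fun a => push c (f a) := by
  refine measurable_pi_lambda _ fun n => ?_
  cases n with
  | zero => exact measurable_const
  | succ n => exact (measurable_pi_apply n).comp hf

lemma abs_avg_le {h : Ray → ℝ} (hb : ∀ s, |h s| ≤ 1) (N : ℕ) : |avg N h| ≤ 1 := by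
  induction N generalizing h with
  | zero => exact hb _
  | succ N ih =>
    have h0 := abs_le.1 (ih fun s => hb (push 0 s))
    have h1 := abs_le.1 (ih fun s => hb (push 1 s))
    rw [avg, abs_le]
    constructor <;> linarith [h0.1, h0.2, h1.1, h1.2]

lemma measurable_avg {α : Type*} [MeasurableSpace α] {H : α → Ray → ℝ}
    (hm : Measurable fun p : α × Ray => H p.1 p.2) (N : ℕ) : Measurable fun a => avg N (H a) := by
  induction N generalizing H with
  | zero => exact hm.comp (measurable_id.prodMk measurable_const)
  | succ N ih =>
    have h : ∀ c, Measurable fun p : α × Ray => H p.1 (push c p.2) := fun c =>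
      hm.comp (measurable_fst.prodMk (measurable_push measurable_snd c))
    exact ((ih (h 0)).add (ih (h 1))).div_const 2

/-- Averaging over the first bits along a sequence of distinct sites. -/
lemma integral_ray_eq_avg (N : ℕ) {e : ℕ → ℤ} (he : Function.Injective e) {H : Config → Ray → ℝ}
    (hm : Measurable fun p : Config × Ray => H p.1 p.2) (hb : ∀ s τ, |H s τ| ≤ 1)
    (hi : ∀ j s τ, H (flipAt (e j) s) τ = H s τ) (hd : ∀ s, DependsOnFirst N (H s)) :
    ∫ s, H s (fun j => s (e j)) ∂maxEntropy = ∫ s, avg N (H s) ∂maxEntropy := by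
  induction N generalizing e H with
  | zero =>
    refine integral_congr_ae (Filter.Eventually.of_forall fun s => ?_)
    exact hd s _ _ fun i hi => by omega
  | succ N ih =>
    have hray : Measurable fun s : Config => fun j => s (e (j + 1)) :=
      measurable_pi_lambda _ fun j => measurable_pi_apply (e (j + 1))
    have hmc : ∀ c, Measurable fun p : Config × Ray => H p.1 (push c p.2) := fun c =>
      hm.comp (measurable_fst.prodMk (measurable_push measurable_snd c))
    have hme : ∀ c, Measurable fun s : Config => H s (push c fun j => s (e (j + 1))) := fun c =>
      (hmc c).comp (measurable_id.prodMk hray)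
    have step := integral_eq_integral_update (e 0)
      (h := fun c s => H s (push c fun j => s (e (j + 1)))) hme (fun c s => hb _ _) (by
        intro c s
        rw [hi]
        congr 2
        funext j
        have : e (j + 1) ≠ e 0 := fun h => by simpa using he h
        simp [flipAt, this])
    have hl : ∀ s : Config, H s (fun j => s (e j)) = H s (push (s (e 0)) fun j => s (e (j + 1))) := by
      intro s
      congr 1
      exact (push_drop _).symm
    have int : ∀ g : Config → ℝ, Measurable g → (∀ s, |g s| ≤ 1) → Integrable g maxEntropy :=
      fun g hg hb => Integrable.of_bound hg.aestronglyMeasurable 1 (Filter.Eventually.of_forall hb)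
    have ihc : ∀ c, ∫ s, H s (push c fun j => s (e (j + 1))) ∂maxEntropy
        = ∫ s, avg N (fun τ => H s (push c τ)) ∂maxEntropy := fun c =>
      ih (e := fun j => e (j + 1)) (fun a b h => by simpa using he h) (hmc c)
        (fun s τ => hb _ _) (fun j s τ => hi (j + 1) s _) fun s => (hd s).push c
    simp only [hl]
    rw [step, integral_div, integral_add (int _ (hme 0) fun s => hb _ _)
      (int _ (hme 1) fun s => hb _ _), ihc, ihc, ← integral_add
      (int _ (measurable_avg (hmc 0) N) fun s => abs_avg_le (fun τ => hb _ _) N)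
      (int _ (measurable_avg (hmc 1) N) fun s => abs_avg_le (fun τ => hb _ _) N), ← integral_div]
    rfl

lemma measurable_field {α : Type*} [MeasurableSpace α] {l r : α → Ray} {v : α → ZMod 2}
    (hl : Measurable l) (hv : Measurable v) (hr : Measurable r) (m n : ℕ) :
    Measurable fun a => field (l a) (v a) (r a) m n := by
  induction m generalizing n with
  | zero =>
    cases n with
    | zero => simpa only [field] using hv
    | succ n => simp only [field]; exact (measurable_pi_apply n).comp hl
  | succ m ihm =>
    induction n with
    | zero => simp only [field]; exact (measurable_pi_apply m).comp hr
    | succ n ihn =>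
      have : Measurable (fun p : ZMod 2 × ZMod 2 × ZMod 2 => p.1 + bor p.2.1 p.2.2) :=
        measurable_of_countable _
      simp only [field]
      exact this.comp ((ihm n).prodMk (ihn.prodMk (ihm (n + 1))))

lemma measurable_occ : Measurable occ := measurable_of_countable _

lemma abs_occ_le (c : ZMod 2) : |occ c| ≤ 1 := by
  unfold occ; split_ifs <;> simp

lemma avg_mul_left (N : ℕ) (c : ℝ) (h : Ray → ℝ) :
    avg N (fun s => c * h s) = c * avg N h := by
  induction N generalizing h with
  | zero => rfl
  | succ N ih => simp only [avg, ih]; ring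

lemma avg_avg_field (m n : ℕ) (v : ZMod 2) :
    avg (m + n) (fun r => avg (m + n) (fun l => occ (field l v r m n))) = prob m n [] v [] := by
  have e : ∀ r, mean (fun l => occ (field l v r m n))
      = avg (m + n) (fun l => occ (field l v r m n)) := fun r =>
    (dependsOnFirst_field_left m n [] v r).mean_eq
  have d : DependsOnFirst (m + n) (fun r => avg (m + n) (fun l => occ (field l v r m n))) :=
    fun r r' H => avg_congr _ fun l => dependsOnFirst_field_right m n l v [] r r' H
  simp only [prob, pushList_nil, e]
  exact d.mean_eq.symm

/-- Expectations of the field in the maximum entropy state. -/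
lemma integral_field (x : ℤ) (m n : ℕ) {ψ : ZMod 2 → ℝ} (hψ : ∀ c, |ψ c| ≤ 1) :
    ∫ s : Config, ψ (s x) * occ (field (leftRay x s) (s x) (rightRay x s) m n) ∂maxEntropy
      = (ψ 0 * prob m n [] 0 [] + ψ 1 * prob m n [] 1 []) / 2 := by
  have hb : ∀ c d, |ψ c * occ d| ≤ 1 := fun c d => by
    rw [abs_mul]; exact mul_le_one₀ (hψ c) (abs_nonneg _) (abs_occ_le d)
  have hψm : Measurable ψ := measurable_of_countable _
  have hmx : Measurable fun s : Config => s x := measurable_pi_apply x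
  have hmr : Measurable (rightRay x) := measurable_pi_lambda _ fun j => measurable_pi_apply _
  have e1 := integral_ray_eq_avg (m + n) (e := fun j => x - 1 - j) (fun a b h => by simpa using h)
    (H := fun s l => ψ (s x) * occ (field l (s x) (rightRay x s) m n))
    ((hψm.comp (hmx.comp measurable_fst)).mul (measurable_occ.comp (measurable_field
      measurable_snd (hmx.comp measurable_fst) (hmr.comp measurable_fst) m n)))
    (fun s τ => hb _ _) (by
      intro j s τ
      have h1 : flipAt (x - 1 - j) s x = s x := if_neg (by omega)
      have h2 : rightRay x (flipAt (x - 1 - j) s) = rightRay x s :=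
        funext fun i => if_neg (by omega)
      rw [h1, h2])
    (fun s l l' H => congrArg (ψ (s x) * ·) (dependsOnFirst_field_left m n [] (s x) _ l l' H))
  have hmK : Measurable fun p : (Config × Ray) × Ray =>
      ψ (p.1.1 x) * occ (field p.2 (p.1.1 x) p.1.2 m n) := by
    have hv : Measurable fun p : (Config × Ray) × Ray => p.1.1 x :=
      hmx.comp (measurable_fst.comp measurable_fst)
    exact (hψm.comp hv).mul (measurable_occ.comp (measurable_field measurable_snd hv
      (measurable_snd.comp measurable_fst) m n))
  have e2 := integral_ray_eq_avg (m + n) (e := fun j => x + 1 + j) (fun a b h => by simpa using h)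
    (H := fun s r => avg (m + n) (fun l => ψ (s x) * occ (field l (s x) r m n)))
    (measurable_avg (H := fun (p : Config × Ray) l => ψ (p.1 x) * occ (field l (p.1 x) p.2 m n))
      hmK (m + n))
    (fun s τ => abs_avg_le (fun _ => hb _ _) _) (by
      intro j s τ
      have h1 : flipAt (x + 1 + j) s x = s x := if_neg (by omega)
      rw [h1])
    (fun s r r' H => avg_congr _ fun l =>
      congrArg (ψ (s x) * ·) (dependsOnFirst_field_right m n l (s x) [] r r' H))
  have e3 := integral_eq_integral_update x
    (h := fun c _ => avg (m + n) (fun r => avg (m + n) (fun l => ψ c * occ (field l c r m n))))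
    (fun c => measurable_const) (fun c s => abs_avg_le (fun _ => abs_avg_le (fun _ => hb _ _) _) _)
    (fun c s => rfl)
  refine e1.trans (e2.trans (e3.trans ?_))
  simp only [avg_mul_left, avg_avg_field, integral_const, probReal_univ, one_smul]

lemma integral_occ (x : ℤ) : ∫ s : Config, occ (s x) ∂maxEntropy = 1 / 2 := by
  have e := integral_eq_integral_update x (h := fun c _ => occ c) (fun c => measurable_const)
    (fun c s => abs_occ_le c) (fun c s => rfl)
  rw [e]
  simp [occ]

/-- The correlations inside the light cone are given by the response of the field. -/
lemma corr_eq_response (x : ℤ) (m n : ℕ) (h : x + m = n) :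
    corr x (m + n) = response m n / 4 := by
  have hev : ∀ s, evolve (site 1 0) (m + n) s = occ (field (leftRay x (vee x (m + n) s))
      (vee x (m + n) s x) (rightRay x (vee x (m + n) s)) m n) := by
    intro s
    have hp : Even (((m + n : ℕ) : ℤ) + 1 + (x + 1)) := ⟨n + 1, by push_cast; linarith⟩
    rw [evolve_eq, heis_eq, dyn_congr hp, ← dyn_eq_field x (m + n) s m n le_rfl, h, sub_self]
    rfl
  have hsx : ∀ s, site 1 x s = occ (vee x (m + n) s x) := by
    intro s
    simp only [vee, sub_self, Int.natAbs_zero, Nat.min_zero, dyn]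
    rfl
  have hmx : Measurable fun s : Config => s x := measurable_pi_apply x
  have hmr : Measurable (rightRay x) := measurable_pi_lambda _ fun j => measurable_pi_apply _
  have hml : Measurable (leftRay x) := measurable_pi_lambda _ fun j => measurable_pi_apply _
  have hmf : Measurable fun s : Config => occ (field (leftRay x s) (s x) (rightRay x s) m n) :=
    measurable_occ.comp (measurable_field hml hmx hmr m n)
  have hv := measurePreserving_vee x (m + n)
  have e1 := integral_comp_of_measurable hv ((measurable_occ.comp hmx).mul hmf)
  have e2 := integral_comp_of_measurable hv hmf
  have e3 := integral_comp_of_measurable hv (measurable_occ.comp hmx)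
  have f1 := integral_field x m n (ψ := occ) abs_occ_le
  have f2 := integral_field x m n (ψ := fun _ => 1) (fun _ => by simp)
  simp only [Pi.mul_apply, Function.comp_apply] at e1 e2 e3
  simp only [one_mul] at f2
  simp only [corr, connected, expect, hev, hsx]
  rw [e1, e2, e3, f1, f2, integral_occ, response]
  simp only [occ, if_true, show ((0 : ZMod 2) = 1) = False from by simp, if_false]
  ring

/-! ### The coefficient -/

lemma sqrt_seven_sq : ((Real.sqrt 7 : ℝ) : ℂ) ^ 2 = 7 := by
  rw [← Complex.ofReal_pow, Real.sq_sqrt (by norm_num)]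
  norm_num

lemma c0_add_two (t : ℕ) : c0 (t + 2) = -c0 (t + 1) - 2 * c0 t := by
  have h := sqrt_seven_sq
  have hI := Complex.I_sq
  unfold c0
  set q : ℂ := ((Real.sqrt 7 : ℝ) : ℂ)
  have r1 : ((-1 - Complex.I * q) / 2) ^ 2 = -((-1 - Complex.I * q) / 2) - 2 := by
    linear_combination (1 / 4) * q ^ 2 * hI - (1 / 4) * h
  have r2 : ((-1 + Complex.I * q) / 2) ^ 2 = -((-1 + Complex.I * q) / 2) - 2 := by
    linear_combination (1 / 4) * q ^ 2 * hI - (1 / 4) * h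
  rw [pow_add _ t 2, pow_add _ t 2, r1, r2]
  ring

lemma c0_zero : c0 0 = 1 / 2 := by
  unfold c0; ring

lemma c0_one : c0 1 = 0 := by
  have h := sqrt_seven_sq
  have hI := Complex.I_sq
  have hq : ((Real.sqrt 7 : ℝ) : ℂ) ≠ 0 := fun h0 => by rw [h0] at h; norm_num at h
  unfold c0
  set q : ℂ := ((Real.sqrt 7 : ℝ) : ℂ)
  field_simp
  linear_combination (-2 : ℂ) * q * hI

lemma c0_eq_coeff (t : ℕ) : c0 t = (coeff t : ℂ) := by
  induction t using Nat.twoStepInduction with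
  | zero => rw [c0_zero, coeff]; norm_num
  | one => rw [c0_one, coeff]; norm_num
  | more t h0 h1 => rw [c0_add_two, h0, h1, coeff]; push_cast; ring

/-- Pascal's rule term by term, once the sums are extended by vanishing terms to comparable ranges.
-/
lemma sumS_rec (u : ℕ) : sumS (u + 3) = sumS (u + 2) + 4 * sumS u := by
  have ext : ∀ (v N : ℕ), v / 2 + 1 ≤ N →
      sumS v = ∑ m ∈ Finset.range N, 4 ^ m * Nat.choose (v - 2 * m) m := by
    intro v N hN
    refine Finset.sum_subset (Finset.range_subset_range.2 hN) fun m _ hm => ?_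
    rw [Finset.mem_range] at hm
    rw [Nat.choose_eq_zero_of_lt (by omega), mul_zero]
  rw [ext (u + 3) (u + 4) (by omega), ext (u + 2) (u + 4) (by omega), ext u (u + 3) (by omega),
    Finset.sum_range_succ', Finset.sum_range_succ' _ (u + 3), Finset.mul_sum]
  have h : ∀ m ∈ Finset.range (u + 3), 4 ^ (m + 1) * Nat.choose (u + 3 - 2 * (m + 1)) (m + 1)
      = 4 ^ (m + 1) * Nat.choose (u + 2 - 2 * (m + 1)) (m + 1)
        + 4 * (4 ^ m * Nat.choose (u - 2 * m) m) := by
    intro m _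
    by_cases hm : 2 * m ≤ u
    · rw [show u + 3 - 2 * (m + 1) = (u - 2 * m) + 1 by omega,
        show u + 2 - 2 * (m + 1) = u - 2 * m by omega, Nat.choose_succ_succ]
      ring
    · rw [Nat.choose_eq_zero_of_lt (n := u + 3 - 2 * (m + 1)) (by omega),
        Nat.choose_eq_zero_of_lt (n := u + 2 - 2 * (m + 1)) (by omega),
        Nat.choose_eq_zero_of_lt (n := u - 2 * m) (by omega)]
      ring
  rw [Finset.sum_congr rfl h, Finset.sum_add_distrib]
  simp
  ring

lemma sumS_eq_coeff (u : ℕ) : (sumS u : ℝ) = 2 ^ u / 2 + coeff u := by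
  induction u using Nat.strong_induction_on with
  | _ u ih =>
  match u with
  | 0 => norm_num [sumS, coeff]
  | 1 => norm_num [sumS, coeff]
  | 2 => norm_num [sumS, coeff, Finset.sum_range_succ]
  | u + 3 =>
    rw [sumS_rec]
    push_cast
    rw [ih (u + 2) (by omega), ih u (by omega), coeff_succ_succ (u + 1), coeff_succ_succ u]
    ring

/-- The norm form of z²+z+2 doubles at each step; it replaces the estimate of the complex roots. -/
lemma coeff_quadratic (t : ℕ) :
    coeff (t + 1) ^ 2 + coeff (t + 1) * coeff t + 2 * coeff t ^ 2 = 2 ^ t / 2 := by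
  induction t with
  | zero => norm_num [coeff]
  | succ t ih =>
    rw [coeff_succ_succ, pow_succ (2 : ℝ) t]
    linear_combination 2 * ih

/-! ### Decay of the correlations -/

lemma two_rpow_neg_half_sq (t : ℕ) : ((2 : ℝ) ^ (-(t : ℝ) / 2)) ^ 2 = (1 / 2) ^ t := by
  rw [← Real.rpow_natCast, ← Real.rpow_mul (by norm_num)]
  rw [show -(t : ℝ) / 2 * ((2 : ℕ) : ℝ) = -(t : ℝ) by push_cast; ring, Real.rpow_neg (by norm_num),
    Real.rpow_natCast, one_div, inv_pow]

lemma corr_eq_coeff {x : ℤ} {t : ℕ} (ht : 3 ≤ t) (hx : |(x : ℝ)| ≤ (t : ℝ) / 3 + 1)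
    (h : Even (x + (t : ℤ))) : corr x t = (1 / 2) ^ (t + 1) * coeff t := by
  have hx' : 3 * |x| ≤ t + 3 := by
    have : (3 : ℝ) * |(x : ℝ)| ≤ t + 3 := by linarith
    exact_mod_cast this
  obtain ⟨a, ha⟩ := h
  have h1 := abs_le.1 (show |x| ≤ (t + 3) / 3 by omega)
  obtain ⟨n, rfl⟩ := Int.eq_ofNat_of_zero_le (show 0 ≤ a by omega)
  obtain ⟨m, rfl⟩ : ∃ m, t = m + n := ⟨t - n, by omega⟩
  push_cast at *
  -- Here n-2m = (3x-t)/2 is an integer, so 3x-t ≤ 3 already gives `n ≤ 2 * m + 1`; likewise for -x.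
  rw [corr_eq_response x m n (by omega), response_eq (m + n) m n rfl (by omega) (by omega)]
  ring

lemma sq_le_of_coeff (t : ℕ) :
    ((1 / 2 : ℝ) ^ (t + 1) * coeff t) ^ 2 ≤ (1 / 2 * (2 : ℝ) ^ (-(t : ℝ) / 2)) ^ 2 := by
  have h := coeff_quadratic t
  have hc : coeff t ^ 2 ≤ 2 ^ t := by
    nlinarith [sq_nonneg (coeff (t + 1) + coeff t / 2), sq_nonneg (coeff t),
      pow_pos (two_pos : (0 : ℝ) < 2) t]
  rw [mul_pow, mul_pow, two_rpow_neg_half_sq]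
  have e : ((1 / 2 : ℝ) ^ (t + 1)) ^ 2 * 2 ^ t = (1 / 2) ^ 2 * (1 / 2) ^ t := by
    have : (1 / 2 : ℝ) ^ t * 2 ^ t = 1 := by rw [← mul_pow]; norm_num
    linear_combination (1 / 4 : ℝ) * (1 / 2) ^ t * this
  rw [← e]
  exact mul_le_mul_of_nonneg_left hc (by positivity)

lemma abs_corr_le_of_even {x : ℤ} {t : ℕ} (ht : 3 ≤ t) (hx : |(x : ℝ)| ≤ (t : ℝ) / 3 + 1)
    (h : Even (x + (t : ℤ))) : |corr x t| ≤ 1 / 2 * (2 : ℝ) ^ (-(t : ℝ) / 2) := by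
  rw [corr_eq_coeff ht hx h]
  exact abs_le_of_sq_le_sq (sq_le_of_coeff t) (by positivity)

lemma abs_corr_le {x : ℤ} {t : ℕ} (ht : 3 ≤ t) (hx : |(x : ℝ)| ≤ (t : ℝ) / 3 + 1) :
    |corr x t| ≤ 1 * (2 : ℝ) ^ (-(t : ℝ) / 2) := by
  have hpos : (0 : ℝ) < (2 : ℝ) ^ (-(t : ℝ) / 2) := by positivity
  by_cases h : Even (x + (t : ℤ))
  · linarith [abs_corr_le_of_even ht hx h]
  -- At time `t + 1` the parity is right and the region is larger.
  · rw [corr_stagger h]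
    have h' : Even (x + ((t + 1 : ℕ) : ℤ)) := by
      push_cast
      rw [← add_assoc, Int.even_add_one]
      exact h
    have := abs_corr_le_of_even (t := t + 1) (by omega) (by push_cast; linarith) h'
    have hmono : (2 : ℝ) ^ (-((t + 1 : ℕ) : ℝ) / 2) ≤ (2 : ℝ) ^ (-(t : ℝ) / 2) :=
      Real.rpow_le_rpow_of_exponent_le (by norm_num) (by push_cast; linarith)
    linarith

/-- One of `T`, `T + 1` works: if both squares were smaller, the quadratic form would be below 11/32
of 2^T instead of half of it. -/
lemma exists_coeff_sq_ge (T : ℕ) : ∃ t, T ≤ t ∧ (2 : ℝ) ^ t / 16 ≤ coeff t ^ 2 := by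
  by_contra hcon
  push Not at hcon
  have h0 := hcon T le_rfl
  have h1 := hcon (T + 1) (by omega)
  have h := coeff_quadratic T
  rw [pow_succ (2 : ℝ)] at h1
  nlinarith [sq_nonneg (coeff (T + 1) - coeff T), pow_pos (two_pos : (0 : ℝ) < 2) T]

lemma le_abs_of_coeff_sq_ge {t : ℕ} (h : (2 : ℝ) ^ t / 16 ≤ coeff t ^ 2) :
    1 / 8 * (2 : ℝ) ^ (-(t : ℝ) / 2) ≤ |(1 / 2) ^ (t + 1) * coeff t| := by
  refine le_trans (le_abs_self _) (sq_le_sq.1 ?_)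
  rw [mul_pow, mul_pow, two_rpow_neg_half_sq]
  have e : ((1 / 2 : ℝ) ^ (t + 1)) ^ 2 * (2 ^ t / 16) = (1 / 8) ^ 2 * (1 / 2) ^ t := by
    have : (1 / 2 : ℝ) ^ t * 2 ^ t = 1 := by rw [← mul_pow]; norm_num
    linear_combination (1 / 64 : ℝ) * (1 / 2) ^ t * this
  rw [← e]
  exact mul_le_mul_of_nonneg_left h (by positivity)

end RCA54

end

theorem mainTheorem5 :
    -- the closed form of the correlations in the homogeneous region
    (∀ (x : ℤ) (t : ℕ), 3 ≤ t → |(x : ℝ)| ≤ (t : ℝ) / 3 + 1 → Even (x + (t : ℤ)) →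
      ((RCA54.corr x t : ℝ) : ℂ) = (1 / 2) ^ (t + 1) * RCA54.c0 t) ∧
    -- the staggering
    (∀ (x : ℤ) (t : ℕ), ¬ Even (x + (t : ℤ)) → RCA54.corr x t = RCA54.corr x (t + 1)) ∧
    -- for `x + t` even the correlation is the covariance along trajectories
    (∀ (x : ℤ) (t : ℕ), Even (x + (t : ℤ)) → RCA54.corr x t = RCA54.trajCorr x t) ∧
    -- the recurrence, its initial values and solution, and `c_0` in terms of it
    (RCA54.sumS 0 = 1 ∧ RCA54.sumS 1 = 1 ∧ RCA54.sumS 2 = 1 ∧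
      (∀ u : ℕ, 3 ≤ u → RCA54.sumS u = RCA54.sumS (u - 1) + 4 * RCA54.sumS (u - 3)) ∧
      (∀ u : ℕ, (RCA54.sumS u : ℂ) = 2 ^ u / 2 + RCA54.c0 u) ∧
      (∀ t : ℕ, 3 ≤ t →
        RCA54.c0 t = 2 * (RCA54.sumS (t - 3) : ℂ) - (RCA54.sumS (t - 2) : ℂ))) ∧
    -- the decay like `2^(-t/2)`: an upper bound, which is attained up to a constant factor at
    -- arbitrarily large times
    (∃ K : ℝ, 0 < K ∧ ∀ (x : ℤ) (t : ℕ), 3 ≤ t → |(x : ℝ)| ≤ (t : ℝ) / 3 + 1 →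
      |RCA54.corr x t| ≤ K * (2 : ℝ) ^ (-(t : ℝ) / 2)) ∧
    (∃ k : ℝ, 0 < k ∧ ∀ T : ℕ, ∃ t : ℕ, T ≤ t ∧ 3 ≤ t ∧
      ∀ x : ℤ, |(x : ℝ)| ≤ (t : ℝ) / 3 + 1 → Even (x + (t : ℤ)) →
        k * (2 : ℝ) ^ (-(t : ℝ) / 2) ≤ |RCA54.corr x t|) := by
  refine ⟨fun x t ht hx h => ?_, fun x t h => RCA54.corr_stagger h,
    fun x t h => RCA54.corr_eq_trajCorr h, ⟨?_, ?_, ?_, fun u hu => ?_, fun u => ?_, fun t ht => ?_⟩,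
    ⟨1, one_pos, fun x t ht hx => RCA54.abs_corr_le ht hx⟩, ⟨1 / 8, by norm_num, fun T => ?_⟩⟩
  · rw [RCA54.corr_eq_coeff ht hx h, RCA54.c0_eq_coeff]
    push_cast
    ring
  · norm_num [RCA54.sumS]
  · norm_num [RCA54.sumS]
  · norm_num [RCA54.sumS, Finset.sum_range_succ]
  · obtain ⟨v, rfl⟩ := Nat.exists_eq_add_of_le' hu
    exact RCA54.sumS_rec v
  · rw [RCA54.c0_eq_coeff]
    have h := congrArg Complex.ofReal (RCA54.sumS_eq_coeff u)
    push_cast at h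
    exact h
  · obtain ⟨v, rfl⟩ := Nat.exists_eq_add_of_le' ht
    have h : RCA54.coeff (v + 3) = 2 * (RCA54.sumS v : ℝ) - (RCA54.sumS (v + 1) : ℝ) := by
      rw [RCA54.sumS_eq_coeff, RCA54.sumS_eq_coeff, RCA54.coeff_succ_succ (v + 1),
        RCA54.coeff_succ_succ v]
      ring
    rw [RCA54.c0_eq_coeff, h]
    push_cast
    rfl
  · obtain ⟨t, hT, hc⟩ := RCA54.exists_coeff_sq_ge (T + 3)
    refine ⟨t, by omega, by omega, fun x hx h => ?_⟩
    rw [RCA54.corr_eq_coeff (by omega) hx h]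
    exact RCA54.le_abs_of_coeff_sq_ge hc
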